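/- Let $\mathbb{T}=\mathbb{R}/2\pi\mathbb{Z}$, $p(k)=k^4-k^2$ for $k\in\mathbb{Z}$, and $\langle y\rangle=\sqrt{1+|y|^2}$. For $b,s\ge 0$ and $u\in L^2(\mathbb{T}\times\mathbb{R};\mathbb{C})$ put $$\|u\|_{X_{b,s}}=\Big(\sum_{k\in\mathbb{Z}}\int_{\mathbb{R}}\langle k\rangle^{2s}\,\langle\tau-p(k)\rangle^{2b}\,|\hat u(k,\tau)|^2\,d\tau\Big)^{1/2}\in[0,\infty],$$ where $\hat u(k,\tau)$ is the space-time Fourier transform, $\hat u(k,\tau)=\frac1{2\pi}\int_{\mathbb{R}}\int_{\mathbb{T}}e^{-i(kx+\tau t)}u(x,t)\,dx\,dt$ in the sense of Plancherel, and let $X_{b,s}$ be the space of all $u\in L^2(\mathbb{T}\times\mathbb{R})$ with $\|u\|_{X_{b,s}}<\infty$ (equivalently, for $b,s\ge 0$, the completion of the Schwartz functions on $\mathbb{T}\times\mathbb{R}$ in this norm). For $T>0$ let $X_{b,s}^T$ be the space of restrictions to $\mathbb{T}\times(0,T)$ of elements of $X_{b,s}$, with the norm $$\|v\|_{X_{b,s}^T}=\inf\{\|w\|_{X_{b,s}}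 : w\in X_{b,s},\ w=v \text{ a.e. on } \mathbb{T}\times(0,T)\}.$$ Lemma 2.1 (Strichartz estimate). There is a constant $C\geq 0$ such that 1. every $u\in X_{5/16,0}$ belongs to $L^4(\mathbb{T}\times\mathbb{R})$ and satisfies $$\|u\|_{L^4(\mathbb{T}\times\mathbb{R})}\le C\,\|u\|_{X_{5/16,0}};$$ 2. for every $T>0$, every $v\in X_{5/16,0}^T$ belongs to $L^4(\mathbb{T}\times(0,T))$ and satisfies, with the same $C$ (independent of $T$), $$\|v\|_{L^4(\mathbb{T}\times(0,T))}\le C\,\|v\|_{X_{5/16,0}^T}.$$ -/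

import Mathlib

open MeasureTheory
open scoped ENNReal NNReal FourierTransform

noncomputable section

instance fact_two_pi_pos : Fact (0 < 2 * Real.pi) := ⟨Real.two_pi_pos⟩

/-- The torus `𝕋 = ℝ / 2πℤ`, with Lebesgue measure of total mass `2π` as its `volume`. -/
abbrev Torus : Type := AddCircle (2 * Real.pi)

/-- The space `L²(𝕋 × ℝ; ℂ)`. -/
abbrev SpaceTimeL2 : Type := Lp (α := Torus × ℝ) ℂ 2 volume

/-- The Fourier coefficient in the space variable, as a function of time:
`t ↦ (1 / 2π) ∫_𝕋 e^{-ikx} u(x, t) dx`. -/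
def spaceCoeff (u : Torus × ℝ → ℂ) (k : ℤ) (t : ℝ) : ℂ :=
  fourierCoeff (fun x : Torus => u (x, t)) k

/-- The space Fourier coefficients of an `L²(𝕋 × ℝ)` function are in `L²(ℝ)`. -/
theorem memLp_spaceCoeff {u : Torus × ℝ → ℂ} (hu : MemLp u 2 volume) (k : ℤ) :
    MemLp (spaceCoeff u k) 2 volume := by
  have hac : (AddCircle.haarAddCircle : Measure Torus) ≪ volume := by
    rw [AddCircle.volume_eq_smul_haarAddCircle]
    refine Measure.absolutelyContinuous_smul ?_
    simp [Real.pi_pos]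
  set μ : Measure Torus := AddCircle.haarAddCircle with hμ
  have hm : AEStronglyMeasurable u (μ.prod (volume : Measure ℝ)) :=
    hu.1.mono_ac (hac.prod Measure.AbsolutelyContinuous.rfl)
  have hc : AEStronglyMeasurable (fun z : Torus × ℝ => fourier (-k) z.1 • u z)
      (μ.prod (volume : Measure ℝ)) :=
    (((fourier (-k)).continuous.comp continuous_fst).aestronglyMeasurable).smul hm
  have hmeas : AEStronglyMeasurable (spaceCoeff u k) volume := hc.prod_swap.integral_prod_right'
  have hfin : ∫⁻ z, ‖u z‖ₑ ^ (2 : ℝ) ∂(μ.prod (volume : Measure ℝ)) < ∞ := by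
    have h1 : ∫⁻ z, ‖u z‖ₑ ^ (2 : ℝ) ∂(volume : Measure (Torus × ℝ)) < ∞ := by
      simpa using lintegral_rpow_enorm_lt_top_of_eLpNorm_lt_top (by simp) (by simp) hu.2
    have h2 : (volume : Measure (Torus × ℝ)) =
        ENNReal.ofReal (2 * Real.pi) • μ.prod (volume : Measure ℝ) := by
      rw [Measure.volume_eq_prod, AddCircle.volume_eq_smul_haarAddCircle, Measure.prod_smul_left]
    rw [h2, lintegral_smul_measure, smul_eq_mul] at h1
    rcases ENNReal.mul_lt_top_iff.1 h1 with h | h | h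
    · exact h.2
    · exact absurd h (by simp [Real.pi_pos])
    · rw [h]; exact ENNReal.zero_lt_top
  refine ⟨hmeas, ?_⟩
  rw [eLpNorm_lt_top_iff_lintegral_rpow_enorm_lt_top (by simp) (by simp)]
  have hsec : ∀ᵐ t ∂(volume : Measure ℝ), AEStronglyMeasurable (fun x => u (x, t)) μ :=
    hm.prod_swap.prodMk_left
  have hswap : ∫⁻ t : ℝ, ∫⁻ x, ‖u (x, t)‖ₑ ^ (2 : ℝ) ∂μ =
      ∫⁻ z, ‖u z‖ₑ ^ (2 : ℝ) ∂(μ.prod (volume : Measure ℝ)) :=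
    (lintegral_prod_symm _ (hm.enorm.pow_const _)).symm
  refine lt_of_le_of_lt (lintegral_mono_ae ?_) (hswap ▸ hfin)
  filter_upwards [hsec] with t ht
  have h1 : ‖spaceCoeff u k t‖ₑ ≤ eLpNorm (fun x => u (x, t)) 1 μ := by
    rw [eLpNorm_one_eq_lintegral_enorm]
    refine (enorm_integral_le_lintegral_enorm _).trans (lintegral_mono fun x => le_of_eq ?_)
    rw [enorm_smul]
    have : ‖fourier (-k) x‖ₑ = 1 := by
      rw [← ofReal_norm, fourier_apply, Circle.norm_coe, ENNReal.ofReal_one]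
    rw [this, one_mul]
  have h2 := h1.trans (eLpNorm_le_eLpNorm_of_exponent_le (one_le_two : (1 : ℝ≥0∞) ≤ 2) ht)
  calc ‖spaceCoeff u k t‖ₑ ^ (2 : ℝ≥0∞).toReal
      ≤ (eLpNorm (fun x => u (x, t)) 2 μ) ^ (2 : ℝ) := by
        simpa using ENNReal.rpow_le_rpow h2 (by norm_num : (0 : ℝ) ≤ 2)
    _ = ∫⁻ x, ‖u (x, t)‖ₑ ^ (2 : ℝ) ∂μ := by
        rw [eLpNorm_eq_lintegral_rpow_enorm_toReal (by simp) (by simp), ← ENNReal.rpow_mul]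
        norm_num

/-- The space-time Fourier transform of `u ∈ L²(𝕋 × ℝ)`, in the unitary normalization
`û(k, τ) = (1 / 2π) ∫_ℝ ∫_𝕋 e^{-i(kx + τt)} u(x, t) dx dt`,
the time integral being understood in the sense of Plancherel. Mathlib's Fourier transform `𝓕` on
`L²(ℝ)` has the kernel `e^{-2πitξ}`, so it is evaluated at `ξ = τ / 2π`. -/
def spaceTimeFourier (u : SpaceTimeL2) (k : ℤ) (τ : ℝ) : ℂ :=
  (𝓕 ((memLp_spaceCoeff (Lp.memLp u) k).toLp (spaceCoeff u k)) : Lp (α := ℝ) ℂ 2 volume)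
    (τ / (2 * Real.pi))

/-- The symbol `p(k) = k⁴ - k²`. -/
def symbol (k : ℤ) : ℝ := (k : ℝ) ^ 4 - (k : ℝ) ^ 2

/-- The bracket `⟨y⟩ = √(1 + |y|²)`. -/
def bracket (y : ℝ) : ℝ := Real.sqrt (1 + |y| ^ 2)

/-- The Bourgain norm
`(∑_k ∫_ℝ ⟨k⟩^{2s} ⟨τ - p(k)⟩^{2b} |û(k, τ)|² dτ)^{1/2} ∈ [0, ∞]` of `u ∈ L²(𝕋 × ℝ)`. -/
def bourgainNorm (b s : ℝ) (u : SpaceTimeL2) : ℝ≥0∞ :=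
  (∑' k : ℤ, ∫⁻ τ : ℝ,
    ENNReal.ofReal (bracket k ^ (2 * s) * bracket (τ - symbol k) ^ (2 * b)) *
      ‖spaceTimeFourier u k τ‖ₑ ^ 2) ^ (1 / 2 : ℝ)

/-- Membership in the Bourgain space `X_{b,s}`, for `b, s ≥ 0`. In this range the norm dominates
the norm of `L²(𝕋 × ℝ)`, and the completion of the Schwartz functions on `𝕋 × ℝ` is the space of
the `L²` functions whose Bourgain norm is finite. -/
def MemBourgain (b s : ℝ) (u : SpaceTimeL2) : Prop := bourgainNorm b s u < ∞

/-- `w` is an extension of `v` from `𝕋 × I` to `𝕋 × ℝ` that belongs to `X_{b,s}`. -/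
def IsBourgainExtension (b s : ℝ) (I : Set ℝ) (v : Torus × ℝ → ℂ) (w : SpaceTimeL2) : Prop :=
  MemBourgain b s w ∧ w =ᵐ[volume.restrict (Set.univ ×ˢ I)] v

/-- Membership in the restriction space `X_{b,s}(I)`, for `b, s ≥ 0`; only the values of `v` on
`𝕋 × I` matter. -/
def MemBourgainOn (b s : ℝ) (I : Set ℝ) (v : Torus × ℝ → ℂ) : Prop :=
  ∃ w : SpaceTimeL2, IsBourgainExtension b s I v w

/-- The norm of the restriction space `X_{b,s}(I)`: the infimum of the Bourgain norms of the
extensions. -/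
def bourgainNormOn (b s : ℝ) (I : Set ℝ) (v : Torus × ℝ → ℂ) : ℝ≥0∞ :=
  ⨅ (w : SpaceTimeL2) (_ : IsBourgainExtension b s I v w), bourgainNorm b s w

end

open Filter
open scoped Topology Convolution

/-! The fourth power of the L⁴ norm of `u` is the squared L² norm of `u²`, whose Fourier transform
is up to constants the self-convolution of `û`. Split `û` into shells on which the modulation `⟨τ -
p(k)⟩` is about `2^j`. By Cauchy–Schwarz, the convolution of the pieces `i` and `j` costs in L² the
square root of the measure of pairs in shells `i`, `j` with a given sum
(`lintegral_sq_lconvolution_le`). In such pairs the time frequency lies in a set of size `2^min`.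
Since `p(k₁) + p(k - k₁)` separates quartically, only `O(2^(max/4))` values of `k₁` remain
(`sub_pow_four_lt_of_symbol`, `modulation_fibre_le`).

The cost `2^(min/2 + max/8)` is `2^(5(i+j)/16)` times the decaying factor `2^(-3|i-j|/16)`, so
Schur's test sums all pairs and `b = 5/16` suffices (`lintegral_sq_lconvolution_self_le`). This is
applied to truncations of `û` to finitely many `k` and bounded `τ`, where the convolution theorem is
elementary; Fatou's lemma along an a.e. convergent subsequence removes the truncation. The local
estimate follows by restricting extensions. -/

theorem ENNReal.mul_le_sq_add_sq (a b : ℝ≥0∞) : a * b ≤ a ^ 2 + b ^ 2 := by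
  rcases le_total a b with h | h
  · calc a * b ≤ b * b := by gcongr
      _ = b ^ 2 := (sq b).symm
      _ ≤ _ := le_add_self
  · calc a * b ≤ a * a := by gcongr
      _ = a ^ 2 := (sq a).symm
      _ ≤ _ := le_self_add

/-- Cauchy–Schwarz for the Lebesgue integral. -/
theorem lintegral_mul_le_sqrt_mul_sqrt {α : Type*} [MeasurableSpace α] (μ : Measure α)
    {f g : α → ℝ≥0∞} (hf : AEMeasurable f μ) (hg : AEMeasurable g μ) :
    ∫⁻ x, f x * g x ∂μ ≤ (∫⁻ x, f x ^ 2 ∂μ) ^ (1 / 2 : ℝ) * (∫⁻ x, g x ^ 2 ∂μ) ^ (1 / 2 : ℝ) := by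
  simpa using ENNReal.lintegral_mul_le_Lp_mul_Lq μ Real.HolderConjugate.two_two hf hg

/-- Minkowski's inequality in `L²` for countable sums of nonnegative functions. -/
theorem lintegral_sq_tsum_le {α ι : Type*} [MeasurableSpace α] [Countable ι] (μ : Measure α)
    {f : ι → α → ℝ≥0∞} (hf : ∀ i, Measurable (f i)) :
    ∫⁻ x, (∑' i, f i x) ^ 2 ∂μ ≤ (∑' i, (∫⁻ x, f i x ^ 2 ∂μ) ^ (1 / 2 : ℝ)) ^ 2 := by
  simp_rw [sq (∑' _, _), ← ENNReal.tsum_mul_left, ← ENNReal.tsum_mul_right]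
  rw [lintegral_tsum (fun i => by fun_prop)]
  refine ENNReal.tsum_le_tsum fun i => ?_
  rw [lintegral_tsum (fun i => by fun_prop)]
  exact ENNReal.tsum_le_tsum fun j =>
    lintegral_mul_le_sqrt_mul_sqrt μ (hf j).aemeasurable (hf i).aemeasurable

/-! ### Convolutions in L² and fibres of addition -/

section Convolution

variable {G : Type*} [AddCommGroup G] [MeasurableSpace G] [MeasurableAdd₂ G] [MeasurableNeg G]

/-- The `L²` norm of a convolution is controlled by the size of the fibres of the addition map
over the product of the supports. -/
theorem lintegral_sq_lconvolution_le (ν : Measure G) [SFinite ν] [ν.IsAddLeftInvariant]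
    {F H : G → ℝ≥0∞} (hF : Measurable F) (hH : Measurable H) {S T : Set G}
    (hS : MeasurableSet S) (hT : MeasurableSet T) (hFS : ∀ y ∉ S, F y = 0)
    (hHT : ∀ y ∉ T, H y = 0) {D : ℝ≥0∞} (hD : ∀ z, ν {y | y ∈ S ∧ -y + z ∈ T} ≤ D) :
    ∫⁻ z, lconvolution F H ν z ^ 2 ∂ν ≤ D * ((∫⁻ y, F y ^ 2 ∂ν) * ∫⁻ y, H y ^ 2 ∂ν) := by
  have key : ∀ z, lconvolution F H ν z ^ 2 ≤
      D * ∫⁻ y, F y ^ 2 * H (-y + z) ^ 2 ∂ν := fun z => by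
    set E : Set G := {y | y ∈ S ∧ -y + z ∈ T}
    have hE : MeasurableSet E :=
      hS.inter (measurable_neg.add_const z hT)
    have h1 : lconvolution F H ν z
        = ∫⁻ y, E.indicator 1 y * (F y * H (-y + z)) ∂ν := by
      refine lintegral_congr fun y => ?_
      by_cases hy : y ∈ E
      · simp [hy]
      · rw [Set.indicator_of_notMem hy, zero_mul]
        by_cases h : y ∈ S
        · rw [hHT _ fun h' => hy ⟨h, h'⟩, mul_zero]
        · rw [hFS _ h, zero_mul]
    -- Cauchy–Schwarz against the indicator of the fibre: its squared L² norm is the measure bounded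
    -- by `D`.
    have h2 := lintegral_mul_le_sqrt_mul_sqrt ν (f := E.indicator 1)
      (g := fun y => F y * H (-y + z)) ((measurable_one.indicator hE).aemeasurable)
      (by fun_prop)
    rw [← h1] at h2
    have h3 : ∫⁻ y, E.indicator (1 : G → ℝ≥0∞) y ^ 2 ∂ν ≤ D := by
      refine le_trans (le_of_eq ?_) (hD z)
      rw [← lintegral_indicator_one hE]
      refine lintegral_congr fun y => ?_
      by_cases hy : y ∈ E <;> simp [hy]
    calc lconvolution F H ν z ^ 2 ≤ _ := pow_le_pow_left' h2 2
      _ = (∫⁻ y, E.indicator (1 : G → ℝ≥0∞) y ^ 2 ∂ν) * ∫⁻ y, (F y * H (-y + z)) ^ 2 ∂ν := by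
        rw [mul_pow, ← ENNReal.rpow_mul_natCast, ← ENNReal.rpow_mul_natCast]; norm_num
      _ ≤ _ := by simp_rw [mul_pow]; gcongr
  calc ∫⁻ z, lconvolution F H ν z ^ 2 ∂ν
      ≤ ∫⁻ z, D * ∫⁻ y, F y ^ 2 * H (-y + z) ^ 2 ∂ν ∂ν := lintegral_mono key
    _ = D * ∫⁻ z, ∫⁻ y, F y ^ 2 * H (-y + z) ^ 2 ∂ν ∂ν := by
      rw [lintegral_const_mul]; fun_prop
    _ = D * ∫⁻ y, ∫⁻ z, F y ^ 2 * H (-y + z) ^ 2 ∂ν ∂ν := by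
      rw [lintegral_lintegral_swap]; fun_prop
    _ = D * ∫⁻ y, F y ^ 2 * ∫⁻ z, H z ^ 2 ∂ν ∂ν := by
      congr 1
      refine lintegral_congr fun y => ?_
      rw [lintegral_const_mul _ (by fun_prop),
        lintegral_add_left_eq_self (fun z => H z ^ 2) (-y)]
    _ = _ := by rw [lintegral_mul_const _ (by fun_prop)]

theorem lconvolution_tsum (ν : Measure G) {ι κ : Type*} [Countable ι] [Countable κ]
    {f : ι → G → ℝ≥0∞} {g : κ → G → ℝ≥0∞} (hf : ∀ i, Measurable (f i))
    (hg : ∀ i, Measurable (g i)) (z : G) :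
    lconvolution (fun y => ∑' i, f i y) (fun y => ∑' i, g i y) ν z
      = ∑' p : ι × κ, lconvolution (f p.1) (g p.2) ν z := by
  simp only [lconvolution_def]
  rw [← lintegral_tsum (fun p => by
    have := hf p.1; have := hg p.2; fun_prop)]
  refine lintegral_congr fun y => ?_
  rw [ENNReal.tsum_prod']
  simp_rw [ENNReal.tsum_mul_left, ENNReal.tsum_mul_right]

end Convolution

/-! ### Dyadic decomposition and Schur's test -/

theorem tsum_pow_natAbs_lt_top {r : ℝ≥0∞} (hr : r < 1) : ∑' n : ℤ, r ^ n.natAbs < ∞ := by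
  have hgeo : ∑' n : ℕ, r ^ n < ∞ := by
    rw [ENNReal.tsum_geometric]
    exact ENNReal.inv_lt_top.2 (tsub_pos_of_lt hr)
  rw [← (Equiv.intEquivNatSumNat.symm).tsum_eq,
    Summable.tsum_sum ENNReal.summable ENNReal.summable]
  refine ENNReal.add_lt_top.2 ⟨by simpa [Equiv.intEquivNatSumNat] using hgeo, ?_⟩
  refine lt_of_le_of_lt (ENNReal.tsum_le_tsum fun n => ?_) hgeo
  simp only [Equiv.intEquivNatSumNat, Equiv.coe_fn_symm_mk, Sum.elim_inr, Int.natAbs_negSucc]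
  exact pow_le_pow_right_of_le_one' hr.le n.le_succ

/-- Schur's test for the kernel `r ^ |i - j|`. -/
theorem tsum_tsum_pow_natAbs_mul_le (r : ℝ≥0∞) (b : ℕ → ℝ≥0∞) :
    ∑' p : ℕ × ℕ, r ^ ((p.1 : ℤ) - p.2).natAbs * (b p.1 * b p.2)
      ≤ 2 * (∑' n : ℤ, r ^ n.natAbs) * ∑' i, b i ^ 2 := by
  have h : ∀ i : ℕ, ∑' j : ℕ, r ^ ((i : ℤ) - j).natAbs ≤ ∑' n : ℤ, r ^ n.natAbs := fun i =>
    ENNReal.tsum_comp_le_tsum_of_injective (f := fun j : ℕ => (i : ℤ) - j)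
      (fun a b h => by simpa using h) fun n => r ^ n.natAbs
  have h1 : ∑' p : ℕ × ℕ, r ^ ((p.1 : ℤ) - p.2).natAbs * b p.1 ^ 2
      ≤ (∑' n : ℤ, r ^ n.natAbs) * ∑' i, b i ^ 2 := by
    rw [ENNReal.tsum_prod']
    simp_rw [ENNReal.tsum_mul_right]
    rw [← ENNReal.tsum_mul_left]
    exact ENNReal.tsum_le_tsum fun i => by gcongr; exact h i
  have h2 : ∑' p : ℕ × ℕ, r ^ ((p.1 : ℤ) - p.2).natAbs * b p.2 ^ 2
      = ∑' p : ℕ × ℕ, r ^ ((p.1 : ℤ) - p.2).natAbs * b p.1 ^ 2 := by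
    rw [← (Equiv.prodComm ℕ ℕ).tsum_eq]
    refine tsum_congr fun p => ?_
    simp only [Equiv.prodComm_apply, Prod.fst_swap, Prod.snd_swap]
    rw [← Int.natAbs_neg, neg_sub]
  -- The kernel is symmetric, so the two squares contribute equally; this is the factor 2.
  calc _ ≤ ∑' p : ℕ × ℕ, (r ^ ((p.1 : ℤ) - p.2).natAbs * b p.1 ^ 2
          + r ^ ((p.1 : ℤ) - p.2).natAbs * b p.2 ^ 2) :=
        ENNReal.tsum_le_tsum fun p => by
          rw [← mul_add]; gcongr; exact ENNReal.mul_le_sq_add_sq _ _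
    _ ≤ _ := by
        rw [ENNReal.tsum_add, h2, ← two_mul, mul_assoc]; gcongr

/-- The dyadic shell on which `2 ^ j ≤ m < 2 ^ (j + 1)`. -/
def dyadicShell {G : Type*} (m : G → ℝ) (j : ℕ) : Set G :=
  {y | (2 : ℝ) ^ j ≤ m y ∧ m y < 2 ^ (j + 1)}

theorem measurableSet_dyadicShell {G : Type*} [MeasurableSpace G] {m : G → ℝ} (hm : Measurable m) (j : ℕ) :
    MeasurableSet (dyadicShell m j) :=
  (measurableSet_le measurable_const hm).inter (measurableSet_lt hm measurable_const)

theorem tsum_indicator_dyadicShell {G : Type*} {m : G → ℝ} (hm : ∀ y, 1 ≤ m y) (F : G → ℝ≥0∞)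
    (y : G) : ∑' j, (dyadicShell m j).indicator F y = F y := by
  obtain ⟨n, hn, hn'⟩ := exists_nat_pow_near (hm y) one_lt_two
  rw [tsum_eq_single n, Set.indicator_of_mem (show y ∈ dyadicShell m n from ⟨hn, hn'⟩)]
  intro j hj
  refine Set.indicator_of_notMem (fun h => hj ?_) _
  have h1 : j < n + 1 := (pow_lt_pow_iff_right₀ (one_lt_two (α := ℝ))).1 (h.1.trans_lt hn')
  have h2 : n < j + 1 := (pow_lt_pow_iff_right₀ (one_lt_two (α := ℝ))).1 (hn.trans_lt h.2)
  omega

/-- Source of the exponent 5/16: `min/2 + max/8 = 5(i+j)/16 - 3|i-j|/16`. The half-power comes from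
Cauchy–Schwarz, and the second term gives the off-diagonal decay. -/
theorem two_rpow_dyadic (i j : ℕ) :
    ((2 : ℝ≥0∞) ^ (((min i j : ℕ) : ℝ) + ((max i j : ℕ) : ℝ) / 4)) ^ (1 / 2 : ℝ) =
      ((2 : ℝ≥0∞) ^ (-(3 / 16) : ℝ)) ^ ((i : ℤ) - j).natAbs *
        ((2 : ℝ≥0∞) ^ (5 / 16 * i : ℝ) * (2 : ℝ≥0∞) ^ (5 / 16 * j : ℝ)) := by
  rw [← ENNReal.rpow_natCast, ← ENNReal.rpow_mul, ← ENNReal.rpow_mul,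
    ← ENNReal.rpow_add _ _ (by simp) (by simp), ← ENNReal.rpow_add _ _ (by simp) (by simp)]
  congr 1
  rcases le_total i j with h | h
  · have : ((((i : ℤ) - j).natAbs : ℕ) : ℝ) = j - i := by
      rw [show ((i : ℤ) - j).natAbs = j - i by omega, Nat.cast_sub h]
    rw [min_eq_left h, max_eq_right h, this]; ring
  · have : ((((i : ℤ) - j).natAbs : ℕ) : ℝ) = i - j := by
      rw [show ((i : ℤ) - j).natAbs = i - j by omega, Nat.cast_sub h]
    rw [min_eq_right h, max_eq_left h, this]; ring

/-- The shells are disjoint and `m ≥ 2^j` on the `j`-th one, so the squared pieces weighted by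
`2^(5j/8)` add up to at most the weighted integral. -/
theorem tsum_two_rpow_mul_lintegral_sq_le {G : Type*} [MeasurableSpace G] (ν : Measure G)
    {m : G → ℝ} (hm : Measurable m) (hm1 : ∀ y, 1 ≤ m y) {F : G → ℝ≥0∞} (hF : Measurable F) :
    ∑' j : ℕ, ((2 : ℝ≥0∞) ^ (5 / 16 * j : ℝ) *
        (∫⁻ y, (dyadicShell m j).indicator F y ^ 2 ∂ν) ^ (1 / 2 : ℝ)) ^ 2
      ≤ ∫⁻ y, ENNReal.ofReal (m y ^ (5 / 8 : ℝ)) * F y ^ 2 ∂ν := by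
  have hms : ∀ j, MeasurableSet (dyadicShell m j) := measurableSet_dyadicShell hm
  have h : ∀ y, ENNReal.ofReal (m y ^ (5 / 8 : ℝ)) * F y ^ 2 =
      ∑' j, (dyadicShell m j).indicator
        (fun y => ENNReal.ofReal (m y ^ (5 / 8 : ℝ)) * F y ^ 2) y := fun y =>
    (tsum_indicator_dyadicShell hm1
      (fun y => ENNReal.ofReal (m y ^ (5 / 8 : ℝ)) * F y ^ 2) y).symm
  rw [lintegral_congr h, lintegral_tsum fun j => ((by fun_prop : Measurable
    fun y => ENNReal.ofReal (m y ^ (5 / 8 : ℝ)) * F y ^ 2).indicator (hms j)).aemeasurable]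
  refine ENNReal.tsum_le_tsum fun j => ?_
  rw [mul_pow, ← ENNReal.rpow_mul_natCast, ← ENNReal.rpow_mul_natCast]
  norm_num only [ENNReal.rpow_one]
  rw [← lintegral_const_mul _ ((hF.indicator (hms j)).pow_const 2)]
  refine lintegral_mono fun y => ?_
  by_cases hy : y ∈ dyadicShell m j
  · simp only [Set.indicator_of_mem hy]
    gcongr
    calc (2 : ℝ≥0∞) ^ (5 / 16 * j * 2 : ℝ) = ENNReal.ofReal (((2 : ℝ) ^ j) ^ (5 / 8 : ℝ)) := by
          rw [← Real.rpow_natCast, ← Real.rpow_mul (by norm_num),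
            ← ENNReal.ofReal_rpow_of_pos (by norm_num)]
          norm_num; ring_nf
      _ ≤ _ := ENNReal.ofReal_le_ofReal (Real.rpow_le_rpow (by positivity) hy.1 (by norm_num))
  · simp [hy]

/-- The bilinear `L²` estimate behind the Strichartz inequality: if the fibres of the addition map
over products of dyadic shells of the modulation `m` are small, then the square `F ⋆ F` is
controlled in `L²` by the `L²` norm of `F` with weight `m ^ (5 / 8)`. -/
theorem lintegral_sq_lconvolution_self_le {G : Type*} [AddCommGroup G] [MeasurableSpace G]
    [MeasurableAdd₂ G] [MeasurableNeg G] (ν : Measure G) [SFinite ν] [ν.IsAddLeftInvariant]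
    {m : G → ℝ} (hm : Measurable m) (hm1 : ∀ y, 1 ≤ m y) {c : ℝ≥0∞}
    (hc : ∀ (i j : ℕ) (z : G), ν {y | m y < 2 ^ (i + 1) ∧ m (-y + z) < 2 ^ (j + 1)} ≤
      c * 2 ^ (((min i j : ℕ) : ℝ) + ((max i j : ℕ) : ℝ) / 4))
    {F : G → ℝ≥0∞} (hF : Measurable F) :
    ∫⁻ z, lconvolution F F ν z ^ 2 ∂ν ≤
      c * (2 * ∑' n : ℤ, ((2 : ℝ≥0∞) ^ (-(3 / 16) : ℝ)) ^ n.natAbs) ^ 2 *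
        (∫⁻ y, ENNReal.ofReal (m y ^ (5 / 8 : ℝ)) * F y ^ 2 ∂ν) ^ 2 := by
  set r : ℝ≥0∞ := (2 : ℝ≥0∞) ^ (-(3 / 16) : ℝ)
  set f : ℕ → G → ℝ≥0∞ := fun j => (dyadicShell m j).indicator F
  set a : ℕ → ℝ≥0∞ := fun j => (∫⁻ y, f j y ^ 2 ∂ν) ^ (1 / 2 : ℝ)
  have hf : ∀ j, Measurable (f j) := fun j => hF.indicator (measurableSet_dyadicShell hm j)
  have hFf : F = fun y => ∑' j, f j y := funext fun y => (tsum_indicator_dyadicShell hm1 F y).symm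
  have hpair : ∀ p : ℕ × ℕ, (∫⁻ z, lconvolution (f p.1) (f p.2) ν z ^ 2 ∂ν) ^ (1 / 2 : ℝ) ≤
      c ^ (1 / 2 : ℝ) * (r ^ ((p.1 : ℤ) - p.2).natAbs *
        (((2 : ℝ≥0∞) ^ (5 / 16 * p.1 : ℝ) * a p.1) * ((2 : ℝ≥0∞) ^ (5 / 16 * p.2 : ℝ) * a p.2))) :=
    fun p => by
    have h1 := lintegral_sq_lconvolution_le ν (hf p.1) (hf p.2)
      (measurableSet_dyadicShell hm p.1) (measurableSet_dyadicShell hm p.2)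
      (fun y hy => Set.indicator_of_notMem hy _) (fun y hy => Set.indicator_of_notMem hy _)
      (fun z => (measure_mono (fun y (hy : y ∈ dyadicShell m p.1 ∧ -y + z ∈ dyadicShell m p.2) =>
        (⟨hy.1.2, hy.2.2⟩ : m y < 2 ^ (p.1 + 1) ∧ m (-y + z) < 2 ^ (p.2 + 1)))).trans
          (hc p.1 p.2 z))
    refine (ENNReal.rpow_le_rpow h1 (by norm_num : (0 : ℝ) ≤ 1 / 2)).trans (le_of_eq ?_)
    rw [ENNReal.mul_rpow_of_nonneg _ _ (by norm_num), ENNReal.mul_rpow_of_nonneg _ _ (by norm_num),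
      ENNReal.mul_rpow_of_nonneg _ _ (by norm_num), two_rpow_dyadic]
    ring
  calc ∫⁻ z, lconvolution F F ν z ^ 2 ∂ν
      = ∫⁻ z, (∑' p : ℕ × ℕ, lconvolution (f p.1) (f p.2) ν z) ^ 2 ∂ν := by
        refine lintegral_congr fun z => ?_
        rw [← lconvolution_tsum ν hf hf, ← hFf]
    _ ≤ (∑' p : ℕ × ℕ, (∫⁻ z, lconvolution (f p.1) (f p.2) ν z ^ 2 ∂ν) ^ (1 / 2 : ℝ)) ^ 2 :=
        lintegral_sq_tsum_le ν fun p => measurable_lconvolution ν (hf _) (hf _)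
    _ ≤ (c ^ (1 / 2 : ℝ) * (2 * (∑' n : ℤ, r ^ n.natAbs) *
          ∫⁻ y, ENNReal.ofReal (m y ^ (5 / 8 : ℝ)) * F y ^ 2 ∂ν)) ^ 2 := by
        refine pow_le_pow_left' ((ENNReal.tsum_le_tsum hpair).trans ?_) 2
        rw [ENNReal.tsum_mul_left]
        gcongr
        refine (tsum_tsum_pow_natAbs_mul_le r fun j => (2 : ℝ≥0∞) ^ (5 / 16 * j : ℝ) * a j).trans ?_
        exact mul_le_mul_right (tsum_two_rpow_mul_lintegral_sq_le ν hm hm1 hF) _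
    _ = _ := by
        rw [mul_pow, mul_pow _ _ 2, ← ENNReal.rpow_mul_natCast, mul_assoc]
        norm_num

/-! ### Counting representations in a window of `p(k₁) + p(k₂)` -/

theorem Int.encard_le_of_forall_sub_le {s : Set ℤ} {d : ℕ} (h : ∀ a ∈ s, ∀ b ∈ s, b ≤ a + d) :
    s.encard ≤ 2 * d + 1 := by
  rcases s.eq_empty_or_nonempty with rfl | ⟨a, ha⟩
  · simp
  have hs : s ⊆ (Finset.Icc (a - d) (a + d) : Finset ℤ) := fun b hb => by
    have h1 := h a ha b hb
    have h2 := h b hb a ha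
    simp only [Finset.coe_Icc, Set.mem_Icc]
    omega
  refine (Set.encard_le_encard hs).trans ?_
  rw [Set.encard_coe_eq_coe_finsetCard, Int.card_Icc,
    show (a + d + 1 - (a - d)).toNat = 2 * d + 1 by omega]
  simp

/-- Along the fibre `k₁ + k₂ = k`, the values of `p(k₁) + p(k₂)` are quartically separated. -/
theorem sub_pow_four_lt_of_symbol {k a b : ℤ} {lam R : ℝ} (hR : 1 ≤ R)
    (ha : |lam - symbol a - symbol (k - a)| < R) (hb : |lam - symbol b - symbol (k - b)| < R)
    (hak : 0 ≤ 2 * a - k) (hab : a ≤ b) : ((b - a : ℤ) : ℝ) ^ 4 < 16 * R := by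
  rw [abs_lt] at ha hb
  have hx : (0 : ℝ) ≤ 2 * a - k := by exact_mod_cast hak
  have hd : (0 : ℝ) ≤ b - a := by exact_mod_cast sub_nonneg.2 hab
  rcases le_or_gt ((b : ℝ) - a) 1 with hd1 | hd1
  · push_cast
    have : ((b : ℝ) - a) ^ 4 ≤ 1 := pow_le_one₀ hd hd1
    linarith
  -- Integrality upgrades `d > 1` to `d ≥ 2`, exactly what absorbs the term `-k²` in `h2` below:
  -- `d²/2 - 1/2 ≥ 3d²/8`.
  have hd2 : (2 : ℝ) ≤ b - a := by
    have : (1 : ℤ) < b - a := by exact_mod_cast hd1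
    exact_mod_cast (by omega : (2 : ℤ) ≤ b - a)
  simp only [symbol] at ha hb
  push_cast at ha hb ⊢
  set x : ℝ := 2 * a - k with hxdef
  set d : ℝ := b - a with hddef
  have hA : (a : ℝ) = (k + x) / 2 := by rw [hxdef]; ring
  have hB : (b : ℝ) = (k + x) / 2 + d := by rw [hddef, ← hA]; ring
  -- With `k₁ = (k + y)/2` the sum `p(k₁) + p(k - k₁)` is a quadratic polynomial in `y²`, so its
  -- increment from `y = x` to `y = x + 2d` has the factor `(x + 2d)² - x²`.
  have hval : ((b : ℝ) ^ 4 - b ^ 2 + ((k - b) ^ 4 - (k - b) ^ 2)) -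
      ((a : ℝ) ^ 4 - a ^ 2 + ((k - a) ^ 4 - (k - a) ^ 2)) =
      (4 * d ^ 2 + 4 * d * x) * ((2 * x ^ 2 + 4 * d * x + 4 * d ^ 2) / 8 + (3 * k ^ 2 - 2) / 4) := by
    rw [hA, hB]; ring
  have h1 : 4 * d ^ 2 ≤ 4 * d ^ 2 + 4 * d * x := by nlinarith
  have h2 : 3 / 8 * d ^ 2 ≤ (2 * x ^ 2 + 4 * d * x + 4 * d ^ 2) / 8 + (3 * k ^ 2 - 2) / 4 := by
    nlinarith [mul_nonneg hd hx, sq_nonneg x, sq_nonneg (k : ℝ)]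
  have h3 := mul_le_mul h1 h2 (by positivity) (by positivity)
  rw [← hval] at h3
  nlinarith [h3, pow_nonneg hd 4]

/-- The number of representations `k = k₁ + k₂` with `p(k₁) + p(k₂)` in a window of size `R`. -/
theorem encard_symbol_window_le (k : ℤ) (lam : ℝ) {R : ℝ} (hR : 1 ≤ R) {d : ℕ}
    (hd : 16 * R ≤ (d : ℝ) ^ 4) :
    {a : ℤ | |lam - symbol a - symbol (k - a)| < R}.encard ≤ 2 * (2 * d + 1) := by
  set S := {a : ℤ | |lam - symbol a - symbol (k - a)| < R}
  have hclose : ∀ a ∈ S, ∀ b ∈ S, 0 ≤ 2 * a - k → b ≤ a + d := fun a ha b hb hak => by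
    by_contra! h
    have h1 := sub_pow_four_lt_of_symbol hR ha hb hak (by omega)
    have h2 : (d : ℝ) < ((b - a : ℤ) : ℝ) := by exact_mod_cast (by omega : (d : ℤ) < b - a)
    have h3 := pow_lt_pow_left₀ h2 (by positivity) (four_ne_zero)
    linarith
  -- The reflection `a ↦ k - a` reduces the half `2a ≤ k` to the half `2a ≥ k`, where separation
  -- holds.
  have hswap : ∀ a ∈ S, k - a ∈ S := fun a ha => by
    change |lam - symbol (k - a) - symbol (k - (k - a))| < R
    rw [sub_sub_cancel, sub_right_comm]; exact ha
  have hcover : S = (S ∩ {a | 0 ≤ 2 * a - k}) ∪ (S ∩ {a | 2 * a - k ≤ 0}) := by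
    rw [← Set.inter_union_distrib_left, Set.inter_eq_left.2]
    intro a _
    exact le_total 0 (2 * a - k)
  rw [hcover, two_mul (2 * (d : ℕ∞) + 1)]
  refine (Set.encard_union_le _ _).trans (add_le_add ?_ ?_)
  · exact Int.encard_le_of_forall_sub_le fun a ha b hb => hclose a ha.1 b hb.1 ha.2
  · refine Int.encard_le_of_forall_sub_le fun a ha b hb => ?_
    have hb2 : 2 * b - k ≤ 0 := hb.2
    have := hclose (k - b) (hswap b hb.1) (k - a) (hswap a ha.1) (by omega)
    omega

/-! ### Measure of the fibres for the modulation -/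

/-- The modulation `⟨τ - p(k)⟩` in the variable `ξ = τ / 2π`. -/
noncomputable def modulation (z : ℤ × ℝ) : ℝ := bracket (2 * Real.pi * z.2 - symbol z.1)

theorem one_le_bracket (y : ℝ) : 1 ≤ bracket y := by
  rw [bracket, Real.one_le_sqrt]
  linarith [sq_nonneg |y|]

theorem abs_le_bracket (y : ℝ) : |y| ≤ bracket y := by
  rw [bracket]
  exact Real.le_sqrt_of_sq_le (by linarith)

theorem measurable_modulation : Measurable modulation := by
  have h : Measurable symbol := measurable_from_top
  unfold modulation bracket
  have h2 : Measurable fun z : ℤ × ℝ => symbol z.1 := h.comp measurable_fst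
  fun_prop

theorem volume_abs_lt_le (c M : ℝ) (hM : 0 ≤ M) :
    volume {x : ℝ | |2 * Real.pi * x - c| < M} ≤ ENNReal.ofReal M := by
  have : {x : ℝ | |2 * Real.pi * x - c| < M} ⊆ Metric.ball (c / (2 * Real.pi)) (M / 2) := by
    intro x hx
    have hx : |2 * Real.pi * x - c| < M := hx
    have hpi := Real.pi_gt_three
    rw [Metric.mem_ball, Real.dist_eq]
    have h : 2 * Real.pi * x - c = 2 * Real.pi * (x - c / (2 * Real.pi)) := by field_simp
    rw [h, abs_mul, abs_of_pos Real.two_pi_pos] at hx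
    nlinarith [abs_nonneg (x - c / (2 * Real.pi))]
  refine (measure_mono this).trans (le_of_eq ?_)
  rw [Real.volume_ball]; congr 1; ring

/-- Adding the two constraints eliminates the time frequency and confines `k₁` to a window of size
`2^(max + 2)`, to which the counting bound applies. For each such `k₁`, the stricter of the two
constraints bounds the section in `ξ`. -/
theorem modulation_fibre_le (i j : ℕ) (z : ℤ × ℝ) :
    ((Measure.count : Measure ℤ).prod (volume : Measure ℝ))
      {y | modulation y < 2 ^ (i + 1) ∧ modulation (-y + z) < 2 ^ (j + 1)} ≤
      56 * 2 ^ (((min i j : ℕ) : ℝ) + ((max i j : ℕ) : ℝ) / 4) := by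
  obtain ⟨k, ξ⟩ := z
  set n := max i j with hn
  set E := {y | modulation y < 2 ^ (i + 1) ∧ modulation (-y + (k, ξ)) < 2 ^ (j + 1)}
  have hE : MeasurableSet E :=
    (measurableSet_lt measurable_modulation measurable_const).inter
      (measurableSet_lt (measurable_modulation.comp (measurable_neg.add_const _)) measurable_const)
  have hi : ∀ y ∈ E, |2 * Real.pi * y.2 - symbol y.1| < 2 ^ (i + 1) := fun y hy =>
    (abs_le_bracket _).trans_lt hy.1
  have hj : ∀ y ∈ E, |2 * Real.pi * (ξ - y.2) - symbol (k - y.1)| < 2 ^ (j + 1) := fun y hy => by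
    have := (abs_le_bracket _).trans_lt hy.2
    simpa [neg_add_eq_sub] using this
  set S := {a : ℤ | |2 * Real.pi * ξ - symbol a - symbol (k - a)| < 2 ^ (n + 2)}
  have hES : ∀ y ∈ E, y.1 ∈ S := fun y hy => by
    have h1 := hi y hy
    have h2 := hj y hy
    have h3 : (2 : ℝ) ^ (i + 1) ≤ 2 ^ (n + 1) := pow_le_pow_right₀ (by norm_num) (by omega)
    have h4 : (2 : ℝ) ^ (j + 1) ≤ 2 ^ (n + 1) := pow_le_pow_right₀ (by norm_num) (by omega)
    change |2 * Real.pi * ξ - symbol y.1 - symbol (k - y.1)| < 2 ^ (n + 2)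
    rw [show 2 * Real.pi * ξ - symbol y.1 - symbol (k - y.1) =
      (2 * Real.pi * y.2 - symbol y.1) + (2 * Real.pi * (ξ - y.2) - symbol (k - y.1)) by ring]
    refine (abs_add_le _ _).trans_lt ?_
    rw [pow_succ _ (n + 1)]
    linarith
  have hsec : ∀ a : ℤ, volume (Prod.mk a ⁻¹' E) ≤
      S.indicator (fun _ => ENNReal.ofReal (2 ^ (min i j + 1))) a := fun a => by
    by_cases ha : a ∈ S
    · rw [Set.indicator_of_mem ha]
      rcases le_total i j with h | h
      · rw [min_eq_left h]
        exact (measure_mono fun x hx => hi (a, x) hx).trans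
          (volume_abs_lt_le (symbol a) _ (by positivity))
      · rw [min_eq_right h]
        refine le_trans (measure_mono fun x hx => ?_)
          (volume_abs_lt_le (2 * Real.pi * ξ - symbol (k - a)) (2 ^ (j + 1)) (by positivity))
        have := hj (a, x) hx
        rw [← abs_neg] at this
        change |2 * Real.pi * x - (2 * Real.pi * ξ - symbol (k - a))| < 2 ^ (j + 1)
        convert this using 2
        ring
    · have : Prod.mk a ⁻¹' E = ∅ := Set.eq_empty_of_forall_notMem fun x hx => ha (hES (a, x) hx)
      simp [this]
  -- The least integer with `d⁴ ≥ 16 · 2^(n+2)`, as the counting bound requires.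
  set d : ℕ := ⌈(2 : ℝ) * 2 ^ (((n : ℝ) + 2) / 4)⌉₊ with hd
  have hroot : ((2 : ℝ) ^ (((n : ℝ) + 2) / 4)) ^ 4 = 2 ^ (n + 2) := by
    rw [← Real.rpow_natCast, ← Real.rpow_mul (by norm_num), ← Real.rpow_natCast 2 (n + 2)]
    congr 1; push_cast; ring
  have hcard : S.encard ≤ 2 * (2 * d + 1) := encard_symbol_window_le k (2 * Real.pi * ξ) (R := 2 ^ (n + 2))
    (one_le_pow₀ (by norm_num)) (d := d) (by
      rw [← hroot, show (16 : ℝ) = 2 ^ 4 by norm_num, ← mul_pow]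
      exact pow_le_pow_left₀ (by positivity) (Nat.le_ceil _) 4)
  have hcard' : (Measure.count S : ℝ≥0∞) ≤ ENNReal.ofReal (28 * 2 ^ ((n : ℝ) / 4)) := by
    have hpos : (1 : ℝ) ≤ 2 ^ ((n : ℝ) / 4) := Real.one_le_rpow (by norm_num) (by positivity)
    have h2 : (2 : ℝ) ^ (((n : ℝ) + 2) / 4) ≤ 2 * 2 ^ ((n : ℝ) / 4) := by
      calc (2 : ℝ) ^ (((n : ℝ) + 2) / 4) ≤ 2 ^ ((n : ℝ) / 4 + 1) :=
            Real.rpow_le_rpow_of_exponent_le (by norm_num) (by linarith)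
        _ = _ := by rw [Real.rpow_add_one (by norm_num)]; ring
    have h3 : (d : ℝ) ≤ 2 * 2 ^ (((n : ℝ) + 2) / 4) + 1 := (Nat.ceil_lt_add_one (by positivity)).le
    have h4 : (((2 * (2 * d + 1) : ℕ)) : ℝ) ≤ 28 * 2 ^ ((n : ℝ) / 4) := by
      push_cast
      linarith
    rw [Measure.count_apply .of_discrete]
    calc (S.encard : ℝ≥0∞) ≤ ((2 * (2 * d + 1) : ℕ∞) : ℝ≥0∞) := by exact_mod_cast hcard
      _ = ENNReal.ofReal ((2 * (2 * d + 1) : ℕ) : ℝ) := by rw [ENNReal.ofReal_natCast]; norm_cast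
      _ ≤ _ := ENNReal.ofReal_le_ofReal h4
  rw [Measure.prod_apply hE]
  calc ∫⁻ a, volume (Prod.mk a ⁻¹' E) ∂Measure.count
      ≤ ∫⁻ a, S.indicator (fun _ => ENNReal.ofReal (2 ^ (min i j + 1))) a ∂Measure.count :=
        lintegral_mono hsec
    _ = ENNReal.ofReal (2 ^ (min i j + 1)) * Measure.count S := by
        rw [lintegral_indicator_const .of_discrete]
    _ ≤ ENNReal.ofReal (2 ^ (min i j + 1)) * ENNReal.ofReal (28 * 2 ^ ((n : ℝ) / 4)) := by gcongr
    _ = ENNReal.ofReal (56 * 2 ^ (((min i j : ℕ) : ℝ) + (n : ℝ) / 4)) := by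
        rw [← ENNReal.ofReal_mul (by positivity), Real.rpow_add (by norm_num), Real.rpow_natCast]
        congr 1; ring
    _ = _ := by
        rw [ENNReal.ofReal_mul (by norm_num), ← ENNReal.ofReal_rpow_of_pos (by norm_num)]
        norm_num

/-! ### Plancherel in time and Parseval in space -/

theorem lintegral_enorm_sq_eq_eLpNorm_sq {α E : Type*} [MeasurableSpace α] [NormedAddCommGroup E]
    (μ : Measure α) (f : α → E) : ∫⁻ x, ‖f x‖ₑ ^ 2 ∂μ = eLpNorm f 2 μ ^ 2 := by
  have := eLpNorm_nnreal_pow_eq_lintegral (μ := μ) (f := f) (p := 2) (by norm_num)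
  simpa using this.symm

theorem continuous_fourierInv_of_integrable {f : ℝ → ℂ} (hf : Integrable f) :
    Continuous (𝓕⁻ f) :=
  VectorFourier.fourierIntegral_continuous Real.continuous_fourierChar
    (by fun_prop) hf

/-- On `L¹ ∩ L²` the inverse Fourier transform of `L²` is given by the integral. -/
theorem fourierInv_toLp_ae_eq {f : ℝ → ℂ} (hf : Integrable f) (hf2 : MemLp f 2 volume) :
    (𝓕⁻ (hf2.toLp f) : Lp (α := ℝ) ℂ 2 volume) =ᵐ[volume] 𝓕⁻ f := by
  -- Both sides are compared against smooth compactly supported `g`. For the L² transform the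
  -- distributional definition moves `𝓕⁻` onto the test function; for the integral, Fubini does.
  refine ae_eq_of_integral_contDiff_smul_eq
    ((Lp.memLp _).locallyIntegrable (by norm_num))
    (continuous_fourierInv_of_integrable hf).locallyIntegrable fun g hg hgc => ?_
  have hg₁ : HasCompactSupport (Complex.ofRealCLM ∘ g) := hgc.comp_left rfl
  have hg₂ : ContDiff ℝ ((⊤ : ℕ∞) : WithTop ℕ∞) (Complex.ofRealCLM ∘ g) := by fun_prop
  set φ := hg₁.toSchwartzMap hg₂ with hφ
  have hφg : ∀ x, φ x = (g x : ℂ) := fun x => by simp [hφ]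
  have h1 : ∫ x, g x • (𝓕⁻ (hf2.toLp f) : Lp (α := ℝ) ℂ 2 volume) x =
      Lp.toTemperedDistribution (𝓕⁻ (hf2.toLp f) : Lp (α := ℝ) ℂ 2 volume) φ := by
    rw [Lp.toTemperedDistribution_apply]
    simp [hφg]
  rw [h1, ← Lp.fourierInv_toTemperedDistribution_eq, TemperedDistribution.fourierInv_apply,
    Lp.toTemperedDistribution_apply]
  have h2 : ∫ x, (𝓕⁻ φ) x • hf2.toLp f x = ∫ x, (𝓕⁻ φ) x • f x :=
    integral_congr_ae (by filter_upwards [hf2.coeFn_toLp] with x hx; rw [hx])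
  rw [h2, SchwartzMap.fourierInv_coe]
  have h3 := VectorFourier.integral_fourierIntegral_smul_eq_flip (e := Real.fourierChar)
    (μ := (volume : Measure ℝ)) (ν := (volume : Measure ℝ)) (L := -innerₗ ℝ) (f := φ) (g := f)
    Real.continuous_fourierChar (by fun_prop) φ.integrable hf
  refine h3.trans (integral_congr_ae (.of_forall fun x => ?_))
  simp only [hφg]
  rw [← Complex.coe_smul]
  congr 1
  rw [Real.fourierInv_eq]
  simp only [VectorFourier.fourierIntegral]
  simp [mul_comm]

theorem lintegral_enorm_sq_toLp {α : Type*} [MeasurableSpace α] {μ : Measure α} (f : Lp ℂ 2 μ) :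
    ∫⁻ x, ‖f x‖ₑ ^ 2 ∂μ = ‖f‖ₑ ^ 2 := by
  rw [lintegral_enorm_sq_eq_eLpNorm_sq, Lp.enorm_def]

/-- Plancherel's inequality on `L¹`. -/
theorem lintegral_enorm_sq_fourierInv_le {f : ℝ → ℂ} (hf : Integrable f) :
    ∫⁻ x, ‖𝓕⁻ f x‖ₑ ^ 2 ≤ ∫⁻ x, ‖f x‖ₑ ^ 2 := by
  -- No L² hypothesis is needed: an infinite right side makes the bound trivial. Self-convolutions
  -- can thus be used knowing only integrability.
  rcases eq_or_ne (∫⁻ x, ‖f x‖ₑ ^ 2) ∞ with h | h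
  · rw [h]; exact le_top
  have hf2 : MemLp f 2 volume := by
    refine ⟨hf.1, ?_⟩
    rw [lintegral_enorm_sq_eq_eLpNorm_sq] at h
    exact lt_top_iff_ne_top.2 fun h' => h (by simp [h'])
  have h1 := lintegral_enorm_sq_toLp (𝓕⁻ (hf2.toLp f) : Lp (α := ℝ) ℂ 2 volume)
  have h2 := lintegral_enorm_sq_toLp (hf2.toLp f)
  have h3 : ‖(𝓕⁻ (hf2.toLp f) : Lp (α := ℝ) ℂ 2 volume)‖ₑ = ‖hf2.toLp f‖ₑ := by
    rw [← ofReal_norm, ← ofReal_norm, ← Lp.norm_fourier_eq, FourierTransform.fourier_fourierInv_eq]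
  rw [h3, ← h2] at h1
  refine le_of_eq ?_
  calc _ = ∫⁻ x, ‖(𝓕⁻ (hf2.toLp f) : Lp (α := ℝ) ℂ 2 volume) x‖ₑ ^ 2 :=
        lintegral_congr_ae (by filter_upwards [fourierInv_toLp_ae_eq hf hf2] with x hx; rw [hx])
    _ = _ := h1
    _ = _ := lintegral_congr_ae (by filter_upwards [hf2.coeFn_toLp] with x hx; rw [hx])

/-- Plancherel's identity for the difference of an `L²` function and the inverse transform of a
function in `L¹ ∩ L²`. -/
theorem lintegral_enorm_sq_sub_fourierInv {g Φ : ℝ → ℂ} (hg : MemLp g 2 volume)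
    (hΦ : Integrable Φ) (hΦ2 : MemLp Φ 2 volume) :
    ∫⁻ t, ‖g t - 𝓕⁻ Φ t‖ₑ ^ 2 =
      ∫⁻ ξ, ‖(𝓕 (hg.toLp g) : Lp (α := ℝ) ℂ 2 volume) ξ - Φ ξ‖ₑ ^ 2 := by
  have h1 := lintegral_enorm_sq_toLp (hg.toLp g - (𝓕⁻ (hΦ2.toLp Φ) : Lp (α := ℝ) ℂ 2 volume))
  have h2 := lintegral_enorm_sq_toLp ((𝓕 (hg.toLp g) : Lp (α := ℝ) ℂ 2 volume) - hΦ2.toLp Φ)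
  have h3 : ‖hg.toLp g - (𝓕⁻ (hΦ2.toLp Φ) : Lp (α := ℝ) ℂ 2 volume)‖ₑ =
      ‖(𝓕 (hg.toLp g) : Lp (α := ℝ) ℂ 2 volume) - hΦ2.toLp Φ‖ₑ := by
    rw [← ofReal_norm, ← ofReal_norm, ← Lp.norm_fourier_eq (_ - _),
      show ∀ f g : Lp (α := ℝ) ℂ 2 volume, 𝓕 (f - g) = 𝓕 f - 𝓕 g from
        (Lp.fourierTransformₗᵢ ℝ ℂ).map_sub,
      FourierTransform.fourier_fourierInv_eq]
  rw [h3, ← h2] at h1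
  calc _ = _ := lintegral_congr_ae (by
        filter_upwards [Lp.coeFn_sub (hg.toLp g) (𝓕⁻ (hΦ2.toLp Φ) : Lp (α := ℝ) ℂ 2 volume),
          hg.coeFn_toLp, fourierInv_toLp_ae_eq hΦ hΦ2] with x hx hx1 hx2
        rw [← hx1, ← hx2]; exact (congrArg (fun z => ‖z‖ₑ ^ 2) hx).symm)
    _ = _ := h1
    _ = _ := lintegral_congr_ae (by
        filter_upwards [Lp.coeFn_sub (𝓕 (hg.toLp g) : Lp (α := ℝ) ℂ 2 volume) (hΦ2.toLp Φ),
          hΦ2.coeFn_toLp] with x hx hx1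
        rw [← hx1]; exact congrArg (fun z => ‖z‖ₑ ^ 2) hx)

theorem fourierInv_convolution {f g : ℝ → ℂ} (hf : Integrable f) (hg : Integrable g) (t : ℝ) :
    𝓕⁻ (f ⋆[ContinuousLinearMap.mul ℂ ℂ] g) t = 𝓕⁻ f t * 𝓕⁻ g t := by
  simp_rw [Real.fourierInv_eq_fourier_neg]
  exact Real.fourier_mul_convolution_eq hf hg (-t)

/-- Parseval's identity on the torus. -/
theorem lintegral_enorm_sq_eq_tsum_fourierCoeff {g : Torus → ℂ} (hg : MemLp g 2 volume) :
    ∫⁻ x, ‖g x‖ₑ ^ 2 = ENNReal.ofReal (2 * Real.pi) * ∑' k : ℤ, ‖fourierCoeff g k‖ₑ ^ 2 := by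
  have hg' : MemLp g 2 AddCircle.haarAddCircle := hg.haarAddCircle
  have h := hasSum_sq_fourierCoeff (hg'.toLp g)
  have hc : ∀ k, fourierCoeff (hg'.toLp g) k = fourierCoeff g k := fun k => by
    rw [fourierCoeff_congr_ae hg'.coeFn_toLp]
  have h2 : ∫ t : Torus, ‖hg'.toLp g t‖ ^ 2 ∂AddCircle.haarAddCircle
      = ∫ t, ‖g t‖ ^ 2 ∂AddCircle.haarAddCircle :=
    integral_congr_ae (by filter_upwards [hg'.coeFn_toLp] with x hx; rw [hx])
  simp_rw [hc, h2] at h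
  rw [AddCircle.volume_eq_smul_haarAddCircle, lintegral_smul_measure, smul_eq_mul]
  congr 1
  have h3 : ∀ z : ℂ, ‖z‖ₑ ^ 2 = ENNReal.ofReal (‖z‖ ^ 2) := fun z => by
    rw [ENNReal.ofReal_pow (norm_nonneg _), ofReal_norm]
  simp_rw [h3]
  rw [← ENNReal.ofReal_tsum_of_nonneg (fun _ => by positivity) h.summable, h.tsum_eq,
    ofReal_integral_eq_lintegral_ofReal (hg'.integrable_norm_pow (by norm_num))
      (.of_forall fun _ => by positivity)]

theorem ae_memLp_section {w : Torus × ℝ → ℂ} (hw : MemLp w 2 volume) :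
    ∀ᵐ t : ℝ, MemLp (fun x => w (x, t)) 2 volume := by
  have h1 : ∫⁻ t : ℝ, ∫⁻ x : Torus, ‖w (x, t)‖ₑ ^ 2 = ∫⁻ z, ‖w z‖ₑ ^ 2 := by
    rw [Measure.volume_eq_prod, lintegral_prod_symm _ (hw.1.enorm.pow_const _)]
  have h2 : ∫⁻ z, ‖w z‖ₑ ^ 2 ≠ ∞ := by
    rw [lintegral_enorm_sq_eq_eLpNorm_sq]
    exact ENNReal.pow_ne_top hw.2.ne
  have hm : AEStronglyMeasurable w ((volume : Measure Torus).prod (volume : Measure ℝ)) := hw.1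
  rw [← h1] at h2
  have h3 := ae_lt_top' ((hm.enorm.pow_const 2).prod_swap.lintegral_prod_right') h2
  filter_upwards [h3, hm.prod_swap.prodMk_left] with t ht htm
  refine ⟨htm, lt_top_iff_ne_top.2 fun h => ht.ne ?_⟩
  change ∫⁻ x : Torus, ‖w (x, t)‖ₑ ^ 2 = ∞
  rw [lintegral_enorm_sq_eq_eLpNorm_sq, h]; simp

/-- Parseval's identity in the space variable. -/
theorem lintegral_enorm_sq_eq_tsum_spaceCoeff {w : Torus × ℝ → ℂ}
    (hw : AEStronglyMeasurable w volume) (h2 : ∀ᵐ t : ℝ, MemLp (fun x => w (x, t)) 2 volume)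
    (hc : ∀ k, AEMeasurable (spaceCoeff w k) volume) :
    ∫⁻ z, ‖w z‖ₑ ^ 2 =
      ENNReal.ofReal (2 * Real.pi) * ∑' k : ℤ, ∫⁻ t, ‖spaceCoeff w k t‖ₑ ^ 2 := by
  rw [Measure.volume_eq_prod, lintegral_prod_symm _ (hw.enorm.pow_const _),
    ← lintegral_tsum fun k => ((hc k).enorm.pow_const 2), ← lintegral_const_mul' _ _ ENNReal.ofReal_ne_top]
  refine lintegral_congr_ae ?_
  filter_upwards [h2] with t ht
  exact lintegral_enorm_sq_eq_tsum_fourierCoeff ht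

/-- The frequencies `n i` may repeat, as they do for the sums `p.1 + p.2` when a trigonometric
polynomial is squared. -/
theorem fourierCoeff_sum_mul_fourier {ι : Type*} (s : Finset ι) (c : ι → ℂ) (n : ι → ℤ) (k : ℤ) :
    fourierCoeff (fun x : Torus => ∑ i ∈ s, c i * fourier (n i) x) k =
      ∑ i ∈ s, if n i = k then c i else 0 := by
  have h : (fun x : Torus => ∑ i ∈ s, c i * fourier (n i) x) =
      ∑ i ∈ s, fun x : Torus => c i * fourier (n i) x := by
    ext x; simp only [Finset.sum_apply]
  rw [h, fourierCoeff.sum s _ fun i _ => (Continuous.integrable_of_hasCompactSupport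
    (by fun_prop) (HasCompactSupport.of_compactSpace _)), Finset.sum_apply]
  refine Finset.sum_congr rfl fun i _ => ?_
  rw [fourierCoeff.const_mul, fourierCoeff_fourier, Pi.single_apply]
  simp [eq_comm]

theorem fourierInv_finset_sum {ι : Type*} (s : Finset ι) {f : ι → ℝ → ℂ}
    (hf : ∀ i ∈ s, Integrable (f i)) (t : ℝ) :
    𝓕⁻ (∑ i ∈ s, f i) t = ∑ i ∈ s, 𝓕⁻ (f i) t := by
  classical
  induction s using Finset.induction_on with
  | empty => simp [Real.fourierInv_eq]
  | insert a s ha ih =>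
    obtain ⟨h1, h2⟩ := by simpa using hf
    rw [Finset.sum_insert ha, Finset.sum_insert ha, ← ih h2]
    exact congrFun (VectorFourier.fourierIntegral_add (L := -innerₗ ℝ) Real.continuous_fourierChar
      (by fun_prop) h1 (integrable_finsetSum' s h2)) t

/-! ### Functions with finitely many spatial frequencies -/

/-- The measure on `ℤ × ℝ` that is dual to `𝕋 × ℝ`. -/
noncomputable abbrev dualMeasure : Measure (ℤ × ℝ) :=
  (Measure.count : Measure ℤ).prod (volume : Measure ℝ)

theorem lintegral_dualMeasure {f : ℤ × ℝ → ℝ≥0∞} (hf : Measurable f) :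
    ∫⁻ z, f z ∂dualMeasure = ∑' k : ℤ, ∫⁻ ξ, f (k, ξ) := by
  rw [lintegral_prod _ hf.aemeasurable, lintegral_count]

/-- The function on `𝕋 × ℝ` with spatial frequencies in `K` whose Fourier transform is `Φ`. -/
noncomputable def synthesis (K : Finset ℤ) (Φ : ℤ → ℝ → ℂ) (z : Torus × ℝ) : ℂ :=
  ∑ k ∈ K, 𝓕⁻ (Φ k) z.2 * fourier k z.1

section Synthesis

variable {K : Finset ℤ} {Φ : ℤ → ℝ → ℂ}

theorem continuous_synthesis (hΦ : ∀ k, Integrable (Φ k)) : Continuous (synthesis K Φ) := by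
  have := fun k => continuous_fourierInv_of_integrable (hΦ k)
  unfold synthesis
  fun_prop

theorem spaceCoeff_synthesis (hK : ∀ k ∉ K, Φ k = 0) (k : ℤ) (t : ℝ) :
    spaceCoeff (synthesis K Φ) k t = 𝓕⁻ (Φ k) t := by
  simp only [spaceCoeff, synthesis]
  rw [fourierCoeff_sum_mul_fourier, Finset.sum_ite_eq']
  split_ifs with h
  · rfl
  · rw [hK k h]; simp [Real.fourierInv_eq]

/-- The Fourier transform of the square of a synthesis, at spatial frequency `n`. -/
noncomputable def selfConvolution (K : Finset ℤ) (Φ : ℤ → ℝ → ℂ) (n : ℤ) : ℝ → ℂ :=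
  ∑ k ∈ K, Φ k ⋆[ContinuousLinearMap.mul ℂ ℂ] Φ (n - k)

theorem integrable_selfConvolution (hΦ : ∀ k, Integrable (Φ k)) (n : ℤ) :
    Integrable (selfConvolution K Φ n) :=
  integrable_finsetSum' _ fun _ _ => (hΦ _).integrable_convolution _ (hΦ _)

theorem spaceCoeff_synthesis_sq (hΦ : ∀ k, Integrable (Φ k)) (hK : ∀ k ∉ K, Φ k = 0) (n : ℤ)
    (t : ℝ) :
    spaceCoeff (fun z => synthesis K Φ z ^ 2) n t = 𝓕⁻ (selfConvolution K Φ n) t := by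
  have h : (fun x : Torus => synthesis K Φ (x, t) ^ 2) = fun x => ∑ p ∈ K ×ˢ K,
      (𝓕⁻ (Φ p.1) t * 𝓕⁻ (Φ p.2) t) * fourier (p.1 + p.2) x := by
    ext x
    rw [synthesis, sq, Finset.sum_mul_sum, Finset.sum_product]
    refine Finset.sum_congr rfl fun i _ => Finset.sum_congr rfl fun j _ => ?_
    rw [fourier_add]; ring
  rw [spaceCoeff, h, fourierCoeff_sum_mul_fourier, selfConvolution,
    fourierInv_finset_sum _ fun _ _ => (hΦ _).integrable_convolution _ (hΦ _),
    Finset.sum_product]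
  refine Finset.sum_congr rfl fun k _ => ?_
  rw [fourierInv_convolution (hΦ _) (hΦ _)]
  -- For fixed `k` only the partner `n - k` survives; if it lies outside `K`, then `Φ (n - k) = 0`
  -- and both sides vanish.
  simp_rw [← eq_sub_iff_add_eq']
  rw [Finset.sum_ite_eq']
  split_ifs with h
  · rfl
  · rw [hK _ h]; simp [Real.fourierInv_eq]

/-- Triangle inequality in the sum and the integral. All phases are discarded: the bilinear estimate
uses only the moduli. -/
theorem enorm_selfConvolution_le (hm : ∀ k, Measurable (Φ k)) (n : ℤ) (ξ : ℝ) :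
    ‖selfConvolution K Φ n ξ‖ₑ ≤
      lconvolution (fun z => ‖Φ z.1 z.2‖ₑ) (fun z => ‖Φ z.1 z.2‖ₑ) dualMeasure (n, ξ) := by
  have hmeas : Measurable fun z : ℤ × ℝ => ‖Φ z.1 z.2‖ₑ :=
    (measurable_from_prod_countable_right hm : Measurable fun z : ℤ × ℝ => Φ z.1 z.2).enorm
  have hprod : Measurable fun y : ℤ × ℝ =>
      ‖Φ y.1 y.2‖ₑ * ‖Φ (-y + (n, ξ)).1 (-y + (n, ξ)).2‖ₑ :=
    hmeas.mul (hmeas.comp (measurable_neg.add_const (n, ξ)))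
  rw [lconvolution_def, lintegral_dualMeasure hprod, selfConvolution, Finset.sum_apply]
  refine (enorm_sum_le _ _).trans (le_trans (Finset.sum_le_sum fun k _ => ?_)
    (ENNReal.sum_le_tsum K))
  refine (enorm_integral_le_lintegral_enorm _).trans (lintegral_mono fun η => le_of_eq ?_)
  simp [neg_add_eq_sub, enorm_mul]

/-- The fourth power of the `L⁴` norm of a synthesis is controlled by the `L²` norm of the
self-convolution of the modulus of its Fourier transform. -/
theorem lintegral_enorm_synthesis_pow_four_le (hm : ∀ k, Measurable (Φ k))
    (hΦ : ∀ k, Integrable (Φ k)) (hK : ∀ k ∉ K, Φ k = 0) :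
    ∫⁻ z, ‖synthesis K Φ z‖ₑ ^ 4 ≤ ENNReal.ofReal (2 * Real.pi) *
      ∫⁻ z, lconvolution (fun z => ‖Φ z.1 z.2‖ₑ) (fun z => ‖Φ z.1 z.2‖ₑ) dualMeasure z ^ 2
        ∂dualMeasure := by
  have hmeas : Measurable fun z : ℤ × ℝ => ‖Φ z.1 z.2‖ₑ :=
    (measurable_from_prod_countable_right hm : Measurable fun z : ℤ × ℝ => Φ z.1 z.2).enorm
  have hcont : Continuous fun z => synthesis K Φ z ^ 2 := (continuous_synthesis hΦ).pow 2
  have hcoeff : ∀ n, spaceCoeff (fun z => synthesis K Φ z ^ 2) n = 𝓕⁻ (selfConvolution K Φ n) :=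
    fun n => funext (spaceCoeff_synthesis_sq hΦ hK n)
  have h := lintegral_enorm_sq_eq_tsum_spaceCoeff hcont.aestronglyMeasurable
    (.of_forall fun t => Continuous.memLp_of_hasCompactSupport
      (hcont.comp (by fun_prop : Continuous fun x : Torus => (x, t)))
      (HasCompactSupport.of_compactSpace _)) (fun n => by
      rw [hcoeff]
      exact (continuous_fourierInv_of_integrable (integrable_selfConvolution hΦ n)).aemeasurable)
  calc ∫⁻ z, ‖synthesis K Φ z‖ₑ ^ 4 = ∫⁻ z, ‖synthesis K Φ z ^ 2‖ₑ ^ 2 := by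
        simp_rw [enorm_pow, ← pow_mul]
    _ ≤ _ := by
        rw [h, lintegral_dualMeasure
          ((measurable_lconvolution dualMeasure hmeas hmeas).pow_const 2)]
        refine mul_le_mul_right (ENNReal.tsum_le_tsum fun n => ?_) _
        rw [hcoeff]
        refine (lintegral_enorm_sq_fourierInv_le (integrable_selfConvolution hΦ n)).trans
          (lintegral_mono fun ξ => ?_)
        exact pow_le_pow_left' (enorm_selfConvolution_le hm n ξ) 2

theorem lintegral_enorm_sub_synthesis_sq {u : Torus × ℝ → ℂ} (hu : MemLp u 2 volume)
    (hΦ : ∀ k, Integrable (Φ k)) (hΦ2 : ∀ k, MemLp (Φ k) 2 volume) (hK : ∀ k ∉ K, Φ k = 0) :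
    ∫⁻ z, ‖u z - synthesis K Φ z‖ₑ ^ 2 = ENNReal.ofReal (2 * Real.pi) * ∑' k : ℤ,
      ∫⁻ ξ, ‖(𝓕 ((memLp_spaceCoeff hu k).toLp (spaceCoeff u k)) : Lp (α := ℝ) ℂ 2 volume) ξ
        - Φ k ξ‖ₑ ^ 2 := by
  have hsec : ∀ t, MemLp (fun x => synthesis K Φ (x, t)) 2 volume := fun t => by
    have := continuous_synthesis (K := K) hΦ
    exact Continuous.memLp_of_hasCompactSupport (by fun_prop) (HasCompactSupport.of_compactSpace _)
  have hcoeff : ∀ k, spaceCoeff (fun z => u z - synthesis K Φ z) k =ᵐ[volume]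
      fun t => spaceCoeff u k t - 𝓕⁻ (Φ k) t := fun k => by
    filter_upwards [ae_memLp_section hu] with t ht
    rw [← spaceCoeff_synthesis hK]
    simp only [spaceCoeff, fourierCoeff, smul_sub]
    exact integral_sub ((ht.haarAddCircle.integrable (by norm_num)).fourier_smul _)
      (((hsec t).haarAddCircle.integrable (by norm_num)).fourier_smul _)
  rw [lintegral_enorm_sq_eq_tsum_spaceCoeff (w := fun z => u z - synthesis K Φ z)
    (hu.1.sub (continuous_synthesis hΦ).aestronglyMeasurable)]
  · congr 2 with k
    rw [← lintegral_enorm_sq_sub_fourierInv _ (hΦ k) (hΦ2 k)]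
    exact lintegral_congr_ae (by filter_upwards [hcoeff k] with t ht; rw [ht])
  · filter_upwards [ae_memLp_section hu] with t ht using ht.sub (hsec t)
  · exact fun k => ((memLp_spaceCoeff hu k).1.aemeasurable.sub
      (continuous_fourierInv_of_integrable (hΦ k)).aemeasurable).congr (hcoeff k).symm

end Synthesis

/-! ### Rescaled transform and truncation -/

theorem lintegral_comp_div_two_pi {f : ℝ → ℝ≥0∞} (hf : Measurable f) :
    ∫⁻ τ, f τ = ENNReal.ofReal (2 * Real.pi) * ∫⁻ ξ, f (2 * Real.pi * ξ) := by
  conv_lhs => rw [← Real.smul_map_volume_mul_left Real.two_pi_pos.ne', lintegral_smul_measure,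
    lintegral_map hf (by fun_prop), abs_of_pos Real.two_pi_pos, smul_eq_mul]

/-- The space-time Fourier transform in the variable `ξ = τ / 2π`. -/
noncomputable def dualTransform (u : SpaceTimeL2) (k : ℤ) : ℝ → ℂ :=
  (𝓕 ((memLp_spaceCoeff (Lp.memLp u) k).toLp (spaceCoeff u k)) : Lp (α := ℝ) ℂ 2 volume)

theorem measurable_dualTransform (u : SpaceTimeL2) (k : ℤ) : Measurable (dualTransform u k) :=
  (Lp.stronglyMeasurable _).measurable

theorem measurable_uncurry_dualTransform (u : SpaceTimeL2) :
    Measurable fun z : ℤ × ℝ => dualTransform u z.1 z.2 :=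
  measurable_from_prod_countable_right (measurable_dualTransform u)

theorem bourgainNorm_sq (u : SpaceTimeL2) :
    bourgainNorm (5 / 16) 0 u ^ 2 = ENNReal.ofReal (2 * Real.pi) *
      ∫⁻ z, ENNReal.ofReal (modulation z ^ (5 / 8 : ℝ)) * ‖dualTransform u z.1 z.2‖ₑ ^ 2
        ∂dualMeasure := by
  have h1 := (measurable_uncurry_dualTransform u).enorm
  have h2 := measurable_modulation
  rw [lintegral_dualMeasure (by fun_prop), bourgainNorm, ← ENNReal.rpow_mul_natCast,
    ← ENNReal.tsum_mul_left]
  norm_num only [ENNReal.rpow_one]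
  refine tsum_congr fun k => ?_
  have h3 := measurable_dualTransform u k
  have h4 : Measurable bracket := by unfold bracket; fun_prop
  rw [lintegral_comp_div_two_pi]
  · congr 1
    refine lintegral_congr fun ξ => ?_
    simp only [modulation, spaceTimeFourier, dualTransform, Real.rpow_zero, one_mul]
    rw [mul_div_cancel_left₀ _ Real.two_pi_pos.ne']
  · change Measurable fun τ => ENNReal.ofReal _ * ‖dualTransform u k (τ / (2 * Real.pi))‖ₑ ^ 2
    fun_prop

/-- The dual transform cut off to `|k| ≤ n`, `|ξ| ≤ n`. -/
noncomputable def truncation (u : SpaceTimeL2) (n : ℕ) (k : ℤ) : ℝ → ℂ :=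
  if k ∈ Finset.Icc (-n : ℤ) n then (Set.Icc (-n : ℝ) n).indicator (dualTransform u k) else 0

section Truncation

variable (u : SpaceTimeL2)

theorem measurable_truncation (n : ℕ) (k : ℤ) : Measurable (truncation u n k) := by
  unfold truncation
  split_ifs
  · exact (measurable_dualTransform u k).indicator measurableSet_Icc
  · exact measurable_const

theorem memLp_truncation (n : ℕ) (k : ℤ) : MemLp (truncation u n k) 2 volume := by
  unfold truncation
  split_ifs
  · exact (Lp.memLp _).indicator measurableSet_Icc
  · exact MemLp.zero

theorem integrable_truncation (n : ℕ) (k : ℤ) : Integrable (truncation u n k) := by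
  unfold truncation
  split_ifs
  · rw [integrable_indicator_iff measurableSet_Icc]
    exact ((Lp.memLp _).locallyIntegrable (by norm_num)).integrableOn_isCompact isCompact_Icc
  · exact integrable_zero _ _ _

theorem truncation_eq_or (n : ℕ) (k : ℤ) (ξ : ℝ) :
    truncation u n k ξ = dualTransform u k ξ ∨ truncation u n k ξ = 0 := by
  unfold truncation
  split_ifs
  · exact (Set.indicator_eq_zero_or_self _ _ _).symm
  · exact .inr rfl

theorem eventually_truncation_eq (k : ℤ) (ξ : ℝ) :
    ∀ᶠ n in atTop, truncation u n k ξ = dualTransform u k ξ := by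
  filter_upwards [eventually_ge_atTop ⌈|ξ|⌉₊, eventually_ge_atTop k.natAbs] with n h1 h2
  have h3 : |ξ| ≤ n := Nat.ceil_le.1 h1
  rw [truncation, if_pos (by rw [Finset.mem_Icc]; omega)]
  exact Set.indicator_of_mem (Set.mem_Icc.2 (abs_le.1 h3)) _

/-- Plancherel turns the error into an integral over the frequencies cut off, and dominated
convergence applies: the weight is at least 1, so a finite Bourgain norm makes `|û|²` integrable. -/
theorem tendsto_lintegral_sub_synthesis_truncation (hu : MemBourgain (5 / 16) 0 u) :
    Tendsto (fun n : ℕ => ∫⁻ z, ‖u z - synthesis (Finset.Icc (-n : ℤ) n) (truncation u n) z‖ₑ ^ 2)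
      atTop (𝓝 0) := by
  have hmeas := measurable_uncurry_dualTransform u
  have htr : ∀ n, Measurable fun z : ℤ × ℝ => truncation u n z.1 z.2 := fun n =>
    measurable_from_prod_countable_right (measurable_truncation u n)
  have heq : ∀ n : ℕ, ∫⁻ z, ‖u z - synthesis (Finset.Icc (-n : ℤ) n) (truncation u n) z‖ₑ ^ 2 =
      ENNReal.ofReal (2 * Real.pi) *
        ∫⁻ z, ‖dualTransform u z.1 z.2 - truncation u n z.1 z.2‖ₑ ^ 2 ∂dualMeasure := fun n => by
    have := htr n
    rw [lintegral_enorm_sub_synthesis_sq (Lp.memLp u) (integrable_truncation u n)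
      (memLp_truncation u n) (fun k hk => if_neg hk), lintegral_dualMeasure (by fun_prop)]
    rfl
  simp_rw [heq]
  rw [← mul_zero (ENNReal.ofReal (2 * Real.pi))]
  refine ENNReal.Tendsto.const_mul ?_ (.inr ENNReal.ofReal_ne_top)
  rw [← lintegral_zero (μ := dualMeasure)]
  refine tendsto_lintegral_of_dominated_convergence
    (fun z => ‖dualTransform u z.1 z.2‖ₑ ^ 2) (fun n => ?_) (fun n => .of_forall fun z => ?_)
    ?_ (.of_forall fun z => ?_)
  · have := htr n
    fun_prop
  · dsimp only
    rcases truncation_eq_or u n z.1 z.2 with h | h <;> simp [h]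
  · have h1 : bourgainNorm (5 / 16) 0 u ^ 2 < ∞ := ENNReal.pow_lt_top hu
    rw [bourgainNorm_sq] at h1
    have h2 := ENNReal.lt_top_of_mul_ne_top_right h1.ne (by simp [Real.pi_pos])
    refine ((lintegral_mono fun z => ?_).trans_lt h2).ne
    refine le_mul_of_one_le_left' (ENNReal.one_le_ofReal.2 ?_)
    exact Real.one_le_rpow (one_le_bracket _) (by norm_num)
  · refine tendsto_const_nhds.congr' ?_
    filter_upwards [eventually_truncation_eq u z.1 z.2] with n hn
    simp [hn]

end Truncation

/-! ### The Strichartz estimate and its restriction to finite time -/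

/-- The constant in the bilinear estimate for the modulation of `p(k) = k⁴ - k²`. -/
noncomputable def bilinearConst : ℝ≥0∞ :=
  56 * (2 * ∑' n : ℤ, ((2 : ℝ≥0∞) ^ (-(3 / 16) : ℝ)) ^ n.natAbs) ^ 2

theorem bilinearConst_ne_top : bilinearConst ≠ ∞ := by
  have h := tsum_pow_natAbs_lt_top (r := (2 : ℝ≥0∞) ^ (-(3 / 16) : ℝ))
    (ENNReal.rpow_lt_one_of_one_lt_of_neg (by norm_num) (by norm_num))
  exact ENNReal.mul_ne_top (by simp)
    (ENNReal.pow_ne_top (ENNReal.mul_ne_top (by simp) h.ne))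

theorem eLpNorm_synthesis_truncation_le (u : SpaceTimeL2) (n : ℕ) :
    eLpNorm (synthesis (Finset.Icc (-n : ℤ) n) (truncation u n)) 4 volume ≤
      ((bilinearConst.toNNReal + 1 : ℝ≥0) : ℝ≥0∞) * bourgainNorm (5 / 16) 0 u := by
  have htr : Measurable fun z : ℤ × ℝ => ‖truncation u n z.1 z.2‖ₑ :=
    (measurable_from_prod_countable_right (measurable_truncation u n) :
      Measurable fun z : ℤ × ℝ => truncation u n z.1 z.2).enorm
  have h1 := lintegral_enorm_synthesis_pow_four_le (measurable_truncation u n)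
    (integrable_truncation u n) (K := Finset.Icc (-n : ℤ) n) (fun k hk => if_neg hk)
  have h2 := lintegral_sq_lconvolution_self_le dualMeasure measurable_modulation
    (fun y => one_le_bracket _) modulation_fibre_le htr
  have h3 : ∫⁻ z, ENNReal.ofReal (modulation z ^ (5 / 8 : ℝ)) * ‖truncation u n z.1 z.2‖ₑ ^ 2
      ∂dualMeasure ≤ ∫⁻ z, ENNReal.ofReal (modulation z ^ (5 / 8 : ℝ)) *
        ‖dualTransform u z.1 z.2‖ₑ ^ 2 ∂dualMeasure := by
    refine lintegral_mono fun z => ?_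
    rcases truncation_eq_or u n z.1 z.2 with h | h <;> simp [h]
  have h4 : eLpNorm (synthesis (Finset.Icc (-n : ℤ) n) (truncation u n)) 4 volume ^ 4 =
      ∫⁻ z, ‖synthesis (Finset.Icc (-n : ℤ) n) (truncation u n) z‖ₑ ^ 4 := by
    have := eLpNorm_nnreal_pow_eq_lintegral (μ := (volume : Measure (Torus × ℝ)))
      (f := synthesis (Finset.Icc (-n : ℤ) n) (truncation u n)) (p := 4) (by norm_num)
    simpa using this
  set W := ∫⁻ z, ENNReal.ofReal (modulation z ^ (5 / 8 : ℝ)) *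
        ‖dualTransform u z.1 z.2‖ₑ ^ 2 ∂dualMeasure with hW
  -- Adding 1 avoids a fourth root, since `B ≤ (B + 1)⁴`, and makes the constant nonzero.
  have hC : bilinearConst ≤ ((bilinearConst.toNNReal + 1 : ℝ≥0) : ℝ≥0∞) ^ 4 := by
    rw [ENNReal.coe_add, ENNReal.coe_toNNReal bilinearConst_ne_top]
    exact le_self_add.trans (le_self_pow₀ (by simp) (by norm_num))
  -- Parseval yields one factor `2π`, while the fourth power of the Bourgain norm carries `(2π)²`.
  have hpi : (1 : ℝ≥0∞) ≤ ENNReal.ofReal (2 * Real.pi) :=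
    ENNReal.one_le_ofReal.2 (by linarith [Real.pi_gt_three])
  refine (ENNReal.pow_le_pow_left_iff four_ne_zero).1 ?_
  rw [h4, mul_pow, show bourgainNorm (5 / 16) 0 u ^ 4 = (bourgainNorm (5 / 16) 0 u ^ 2) ^ 2 by
    rw [← pow_mul], bourgainNorm_sq, ← hW]
  calc _ ≤ ENNReal.ofReal (2 * Real.pi) * (bilinearConst * W ^ 2) :=
        h1.trans (mul_le_mul_right (h2.trans (mul_le_mul_right (pow_le_pow_left' h3 2) _)) _)
    _ = bilinearConst * (ENNReal.ofReal (2 * Real.pi) * W ^ 2) := by ring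
    _ ≤ _ := by
        refine mul_le_mul' hC ?_
        rw [mul_pow]
        exact mul_le_mul_left (le_self_pow₀ hpi two_ne_zero) _

/-- The Strichartz estimate on `𝕋 × ℝ`. -/
theorem eLpNorm_four_le_bourgainNorm {u : SpaceTimeL2} (hu : MemBourgain (5 / 16) 0 u) :
    eLpNorm u 4 volume ≤
      ((bilinearConst.toNNReal + 1 : ℝ≥0) : ℝ≥0∞) * bourgainNorm (5 / 16) 0 u := by
  set v : ℕ → Torus × ℝ → ℂ := fun n => synthesis (Finset.Icc (-n : ℤ) n) (truncation u n)
  have hv : ∀ n, AEStronglyMeasurable (v n) volume := fun n =>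
    (continuous_synthesis (integrable_truncation u n)).aestronglyMeasurable
  have hlim : Tendsto (fun n => eLpNorm (v n - ⇑u) 2 volume) atTop (𝓝 0) := by
    have h := (tendsto_lintegral_sub_synthesis_truncation u hu).ennrpow_const (1 / 2 : ℝ)
    rw [ENNReal.zero_rpow_of_pos (by norm_num)] at h
    refine h.congr fun n => ?_
    rw [eLpNorm_sub_comm, lintegral_enorm_sq_eq_eLpNorm_sq, ← ENNReal.rpow_natCast,
      ← ENNReal.rpow_mul]
    norm_num
    rfl
  -- L² convergence gives convergence in measure, hence a.e. along a subsequence; the uniform L⁴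
  -- bound then passes to the limit by Fatou.
  obtain ⟨ns, -, hns⟩ := (tendstoInMeasure_of_tendsto_eLpNorm two_ne_zero hv
    (Lp.aestronglyMeasurable u) hlim).exists_seq_tendsto_ae
  exact Lp.eLpNorm_le_of_ae_tendsto
    (.of_forall fun i => eLpNorm_synthesis_truncation_le u (ns i)) (fun i => hv (ns i)) hns

theorem lemma2p1 :
    ∃ C : ℝ≥0,
      (∀ u : SpaceTimeL2, MemBourgain (5 / 16) 0 u →
        MemLp u 4 volume ∧ eLpNorm u 4 volume ≤ C * bourgainNorm (5 / 16) 0 u) ∧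
      (∀ T : ℝ, 0 < T → ∀ v : Torus × ℝ → ℂ, MemBourgainOn (5 / 16) 0 (Set.Ioo 0 T) v →
        MemLp v 4 (volume.restrict (Set.univ ×ˢ Set.Ioo 0 T)) ∧
          eLpNorm v 4 (volume.restrict (Set.univ ×ˢ Set.Ioo 0 T)) ≤
            C * bourgainNormOn (5 / 16) 0 (Set.Ioo 0 T) v) := by
  refine ⟨bilinearConst.toNNReal + 1, fun u hu => ?_, fun T _ v hv => ?_⟩
  · have h := eLpNorm_four_le_bourgainNorm hu
    exact ⟨⟨Lp.aestronglyMeasurable u, h.trans_lt (ENNReal.mul_lt_top ENNReal.coe_lt_top hu)⟩, h⟩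
  · have hw : ∀ w, IsBourgainExtension (5 / 16) 0 (Set.Ioo 0 T) v w →
        eLpNorm v 4 (volume.restrict (Set.univ ×ˢ Set.Ioo 0 T)) ≤
          ((bilinearConst.toNNReal + 1 : ℝ≥0) : ℝ≥0∞) * bourgainNorm (5 / 16) 0 w := fun w hw => by
      rw [← eLpNorm_congr_ae hw.2]
      exact (eLpNorm_mono_measure _ Measure.restrict_le_self).trans
        (eLpNorm_four_le_bourgainNorm hw.1)
    obtain ⟨w, hwe⟩ := hv
    refine ⟨⟨(Lp.aestronglyMeasurable w).restrict.congr hwe.2, (hw w hwe).trans_lt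
      (ENNReal.mul_lt_top ENNReal.coe_lt_top hwe.1)⟩, ?_⟩
    -- The constant is nonzero and finite, so it commutes with both infima, including the inner one
    -- over an empty index, which is `∞`.
    rw [bourgainNormOn, ENNReal.mul_iInf_of_ne (by simp) ENNReal.coe_ne_top]
    refine le_iInf fun w' => ?_
    rw [ENNReal.mul_iInf_of_ne (by simp) ENNReal.coe_ne_top]
    exact le_iInf fun hw' => hw w' hw'
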